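/- A field $\mathcal X=(X,B,\pi)$ is a $1$-Lipschitz map $\pi\colon X\to B$ between Polish (complete separable) metric spaces; it is compact if $X$ is compact and nonempty ($B$ is an arbitrary Polish space). An isometric embedding $\Phi=(f,g)\colon(X,B_X,\pi_X)\Rightarrow(Y,B_Y,\pi_Y)$ of fields is a pair of isometric embeddings $f\colon X\to Y$, $g\colon B_X\to B_Y$ with $\pi_Y\circ f=g\circ\pi_X$; it is an isometry if $f$ and $g$ are also surjective. For compact fields, $$d_{GH}(\mathcal X,\mathcal Y)=\inf d_H^Z\bigl(f(X),f'(Y)\bigr),$$ the infimum over all compact fields $\mathcal Z=(Z,B_Z,\pi_Z)$ and isometric embeddings $(f,g)\colon\mathcal X\Rightarrow\mathcal Z$, $(f',g')\colon\mathcal Y\Rightarrow\mathcal Z$, where $d_H^Z$ is the Hausdorff distance in $Z$. This is a pseudometric on isometry classes of compact fields; the moduli space $(\mathfrak F,d_{GH})$ is the associated metric space, in which classes at distance $0$ are identified. A field $\mathcal U=(U,B,\pi)$ is an ultimate Urysohn field if for all finite $A\subseteq U$, $Z\subseteq B$ with $\pi(A)\subseteq Z$, all one-point metric extensions $A^*=A\sqcup\{a^*\}$,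 $Z^*=Z\sqcup\{z^*\}$ and every $1$-Lipschitz map $p\colon A^*\to Z^*$ with $p|_A=\pi|_A$, there are isometric embeddings $\imath\colon A^*\to U$, $\jmath\colon Z^*\to B$ that restrict to the inclusions of $A$ and $Z$ and satisfy $\pi\circ\imath=\jmath\circ p$. Let $F(\mathcal U)$ be the space of compact subfields of $\mathcal U$, given by their domains, the nonempty compact subsets of $U$, with the Hausdorff distance. Let $Aut(\mathcal U)$ be the group of isometries $(\varphi,\psi)$ of $\mathcal U$ onto itself, acting on $F(\mathcal U)$ by $A\mapsto\varphi(A)$, and let $$d_F^{\mathcal U}([A],[A'])=\inf_{(\varphi,\psi)\in Aut(\mathcal U)}d_H^U(A,\varphi(A'))$$ on the set of orbits $F(\mathcal U)/Aut(\mathcal U)$. Theorem. Let $\mathcal U$ be an ultimate Urysohn field. Then: 1. $d_{GH}$ is finite, and $d_{GH}(\mathcal X,\mathcal Y)=0$ if and only if the fields $X\to\pi_X(X)$ and $Y\to\pi_Y(Y)$, obtained by restricting the codomains to the images, are isometric. 2. Every compact field has an isometric embedding into $\mathcal U$, and there is a bijective isometry from $(\mathfrak F,d_{GH})$ onto $(F(\mathcal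 U)/Aut(\mathcal U),d_F^{\mathcal U})$ that sends the class of $\mathcal X$ to the orbit of $f(X)$, for every isometric embedding $(f,g)\colon\mathcal X\Rightarrow\mathcal U$. In particular, $d_F^{\mathcal U}$ is a metric. -/

import Mathlib

open Set Topology Metric TopologicalSpace
open scoped ENNReal

universe u

noncomputable section

/-- A field: a `1`-Lipschitz map between Polish metric spaces
(complete separable metric spaces). -/
structure PolishField : Type (u + 1) where
  dom : Type u
  cod : Type u
  [metricDom : MetricSpace dom]
  [completeDom : CompleteSpace dom]
  [separableDom : SeparableSpace dom]
  [metricCod : MetricSpace cod]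
  [completeCod : CompleteSpace cod]
  [separableCod : SeparableSpace cod]
  map : dom → cod
  lipschitz : LipschitzWith 1 map

attribute [instance] PolishField.metricDom PolishField.completeDom PolishField.separableDom
  PolishField.metricCod PolishField.completeCod PolishField.separableCod

/-- A compact field: a field whose domain is compact and nonempty; the codomain is an
arbitrary Polish space. -/
structure CompactField : Type (u + 1) extends PolishField.{u} where
  [compactDom : CompactSpace dom]
  [nonemptyDom : Nonempty dom]

attribute [instance] CompactField.compactDom CompactField.nonemptyDom

/-- An isometric embedding of fields with varying codomain: isometric embeddings of the
domains and of the codomains, commuting with the fields. -/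
structure FieldEmbedding (X Y : PolishField.{u}) where
  onDom : X.dom → Y.dom
  onCod : X.cod → Y.cod
  isometry_onDom : Isometry onDom
  isometry_onCod : Isometry onCod
  comm : ∀ x, Y.map (onDom x) = onCod (X.map x)

namespace FieldEmbedding

/-- Composition of isometric embeddings. -/
def comp {X Y Z : PolishField.{u}} (Ψ : FieldEmbedding Y Z) (Φ : FieldEmbedding X Y) :
    FieldEmbedding X Z where
  onDom := Ψ.onDom ∘ Φ.onDom
  onCod := Ψ.onCod ∘ Φ.onCod
  isometry_onDom := Ψ.isometry_onDom.comp Φ.isometry_onDom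
  isometry_onCod := Ψ.isometry_onCod.comp Φ.isometry_onCod
  comm x := by simp [Ψ.comm, Φ.comm]

end FieldEmbedding

namespace PolishField

/-- Two fields are isometric if there are bijective isometries between the domains and
between the codomains that commute with the fields. -/
def Isometric (X Y : PolishField.{u}) : Prop :=
  ∃ (f : X.dom ≃ᵢ Y.dom) (g : X.cod ≃ᵢ Y.cod), ∀ x, Y.map (f x) = g (X.map x)

/-- `𝒰` is an ultimate Urysohn field: for finite `A ⊆ U`, `Z ⊆ B` with `π(A) ⊆ Z`, all
one-point metric extensions `A* = A ⊔ {a*}` and `Z* = Z ⊔ {z*}` (`Option A`, `Option Z` with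
metrics extending those of `A` and `Z`), and every `1`-Lipschitz `p : A* → Z*` extending
`π : A → Z`, there are isometric embeddings `i : A* → U`, `j : Z* → B` extending the
inclusions with `π ∘ i = j ∘ p`. -/
def IsUltimateUrysohn (𝒰 : PolishField.{u}) : Prop :=
  ∀ (A : Set 𝒰.dom) (Z : Set 𝒰.cod), A.Finite → Z.Finite → ∀ (hAZ : MapsTo 𝒰.map A Z)
    [MetricSpace (Option A)] [MetricSpace (Option Z)] (p : Option A → Option Z),
    Isometry (some : A → Option A) → Isometry (some : Z → Option Z) →
    LipschitzWith 1 p → (∀ a : A, p (some a) = some ⟨𝒰.map a, hAZ a.2⟩) →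
    ∃ (i : Option A → 𝒰.dom) (j : Option Z → 𝒰.cod), Isometry i ∧ Isometry j ∧
      (∀ a : A, i (some a) = a) ∧ (∀ z : Z, j (some z) = z) ∧ ∀ x, 𝒰.map (i x) = j (p x)

/-- The automorphism group of a field: pairs of bijective self-isometries of the domain and
of the codomain that commute with the field. -/
def Aut (F : PolishField.{u}) : Subgroup ((F.dom ≃ᵢ F.dom) × (F.cod ≃ᵢ F.cod)) where
  carrier := {g | ∀ x, F.map (g.1 x) = g.2 (F.map x)}
  mul_mem' {a b} ha hb x := by
    simp only [mem_ofPred_eq] at ha hb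
    simp [IsometryEquiv.mul_apply, ha, hb]
  one_mem' _ := rfl
  inv_mem' {a} ha x := by
    simp only [mem_ofPred_eq] at ha
    have h := ha (a.1⁻¹ x)
    rw [← IsometryEquiv.mul_apply, mul_inv_cancel] at h
    change F.map (a.1⁻¹ x) = a.2⁻¹ (F.map x)
    have h2 : F.map x = a.2 (F.map (a.1⁻¹ x)) := h
    rw [h2, ← IsometryEquiv.mul_apply, inv_mul_cancel]
    rfl

/-- The compact subfields of a field `F`, given by their (nonempty, compact) domains, with
the Hausdorff distance between the domains. -/
abbrev CompactSubfields (F : PolishField.{u}) : Type u := NonemptyCompacts F.dom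

/-- `Aut F` acts on the compact subfields by taking images of the domains. -/
instance (F : PolishField.{u}) : MulAction F.Aut F.CompactSubfields where
  smul g A := A.map g.1.1 g.1.1.continuous
  one_smul A := by
    apply NonemptyCompacts.ext
    exact image_id _
  mul_smul g h A := by
    apply NonemptyCompacts.ext
    exact image_comp g.1.1 h.1.1 _

theorem coe_smul (F : PolishField.{u}) (g : F.Aut) (A : F.CompactSubfields) :
    ((g • A : F.CompactSubfields) : Set F.dom) = g.1.1 '' A := rfl

theorem edist_smul (F : PolishField.{u}) (g : F.Aut) (A A' : F.CompactSubfields) :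
    edist (g • A) (g • A') = edist A A' := by
  change hausdorffEDist ((g • A : F.CompactSubfields) : Set F.dom) (g • A' : F.CompactSubfields) =
    hausdorffEDist (A : Set F.dom) A'
  rw [coe_smul, coe_smul]
  exact hausdorffEDist_image g.1.1.isometry

/-- The quotient distance between the orbits of two compact subfields: the infimum over the
automorphisms `g` of the Hausdorff distance between `A` and `g(A')`. -/
def orbitEDist (F : PolishField.{u}) (A A' : F.CompactSubfields) : ℝ≥0∞ :=
  ⨅ g : F.Aut, edist A (g • A')

theorem orbitEDist_comm (F : PolishField.{u}) (A A' : F.CompactSubfields) :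
    F.orbitEDist A A' = F.orbitEDist A' A := by
  suffices h : ∀ A A', F.orbitEDist A A' ≤ F.orbitEDist A' A from le_antisymm (h _ _) (h _ _)
  intro A A'
  refine le_iInf fun g => (iInf_le _ g⁻¹).trans (le_of_eq ?_)
  rw [← F.edist_smul g, smul_inv_smul, edist_comm]

theorem orbitEDist_triangle (F : PolishField.{u}) (A A' A'' : F.CompactSubfields) :
    F.orbitEDist A A'' ≤ F.orbitEDist A A' + F.orbitEDist A' A'' := by
  refine ENNReal.le_iInf_add_iInf fun g h => (iInf_le _ (g * h)).trans ?_
  refine (edist_triangle _ (g • A') _).trans ?_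
  rw [mul_smul, F.edist_smul g]

theorem orbitEDist_smul_right (F : PolishField.{u}) (g : F.Aut) (A A' : F.CompactSubfields) :
    F.orbitEDist A (g • A') = F.orbitEDist A A' := by
  unfold orbitEDist
  rw [← (Equiv.mulRight g).iInf_comp (g := fun h => edist A (h • A'))]
  simp [mul_smul]

theorem orbitEDist_smul_left (F : PolishField.{u}) (g : F.Aut) (A A' : F.CompactSubfields) :
    F.orbitEDist (g • A) A' = F.orbitEDist A A' := by
  rw [orbitEDist_comm, orbitEDist_smul_right, orbitEDist_comm]

/-- The space of orbits of compact subfields of `F` under the automorphism group of `F`. -/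
def SubfieldOrbits (F : PolishField.{u}) : Type u :=
  MulAction.orbitRel.Quotient F.Aut F.CompactSubfields

/-- The orbit of a compact subfield. -/
def orbit (F : PolishField.{u}) (A : F.CompactSubfields) : F.SubfieldOrbits :=
  Quotient.mk (MulAction.orbitRel F.Aut F.CompactSubfields) A

/-- The quotient distance on the orbit space. -/
instance (F : PolishField.{u}) : PseudoEMetricSpace F.SubfieldOrbits where
  edist a b := Quotient.liftOn₂ a b F.orbitEDist (by
    rintro A₁ A₂ A₁' A₂' ⟨g, rfl⟩ ⟨h, rfl⟩
    exact (F.orbitEDist_smul_left g _ _).trans (F.orbitEDist_smul_right h _ _))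
  edist_self a := by
    induction a using Quotient.inductionOn with | _ A
    refine le_antisymm ((iInf_le _ (1 : F.Aut)).trans ?_) bot_le
    simp
  edist_comm a b := by
    induction a, b using Quotient.inductionOn₂ with | _ A A'
    exact F.orbitEDist_comm A A'
  edist_triangle a b c := by
    induction a, b, c using Quotient.inductionOn₃ with | _ A A' A''
    exact F.orbitEDist_triangle A A' A''

theorem edist_orbit (F : PolishField.{u}) (A A' : F.CompactSubfields) :
    edist (F.orbit A) (F.orbit A') = ⨅ g : F.Aut, hausdorffEDist (A : Set F.dom) (g.1.1 '' A') :=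
  rfl

end PolishField

namespace CompactField

/-- The Gromov–Hausdorff distance of compact fields with varying codomain: the infimum, over
all compact fields `Z` and isometric embeddings of `X` and `Y` into `Z`, of the Hausdorff
distance between the images of the domains. -/
def ghEDist (X Y : CompactField.{u}) : ℝ≥0∞ :=
  ⨅ (Z : CompactField.{u}) (Φ : FieldEmbedding X.toPolishField Z.toPolishField)
    (Ψ : FieldEmbedding Y.toPolishField Z.toPolishField),
    hausdorffEDist (range Φ.onDom) (range Ψ.onDom)

theorem ghEDist_le {X Y : CompactField.{u}} (Z : CompactField.{u})
    (Φ : FieldEmbedding X.toPolishField Z.toPolishField)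
    (Ψ : FieldEmbedding Y.toPolishField Z.toPolishField) :
    ghEDist X Y ≤ hausdorffEDist (range Φ.onDom) (range Ψ.onDom) :=
  iInf_le_of_le Z <| iInf_le_of_le Φ <| iInf_le _ Ψ

theorem ghEDist_eq_zero_of_isometric {X Y : CompactField.{u}}
    (h : X.toPolishField.Isometric Y.toPolishField) : ghEDist X Y = 0 := by
  obtain ⟨f, g, hfg⟩ := h
  refine le_antisymm ((ghEDist_le Y ⟨f, g, f.isometry, g.isometry, hfg⟩
    ⟨id, id, isometry_id, isometry_id, fun _ => rfl⟩).trans ?_) bot_le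
  simp [f.surjective.range_eq]

theorem ghEDist_comm (X Y : CompactField.{u}) : ghEDist X Y = ghEDist Y X := by
  suffices h : ∀ X Y : CompactField.{u}, ghEDist X Y ≤ ghEDist Y X from
    le_antisymm (h _ _) (h _ _)
  intro X Y
  refine le_iInf fun Z => le_iInf fun Φ => le_iInf fun Ψ => (ghEDist_le Z Ψ Φ).trans ?_
  rw [hausdorffEDist_comm]

section Glue

variable {X Y Z : Type u} [MetricSpace X] [MetricSpace Y] [MetricSpace Z] [Nonempty Z]
  {Φ : Z → X} {Ψ : Z → Y} (hΦ : Isometry Φ) (hΨ : Isometry Ψ)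

theorem glue_cases (g : GlueSpace hΦ hΨ) :
    (∃ x, toGlueL hΦ hΨ x = g) ∨ ∃ y, toGlueR hΦ hΨ y = g := by
  induction g using Quotient.inductionOn with | _ s
  rcases s with x | y
  · exact Or.inl ⟨x, rfl⟩
  · exact Or.inr ⟨y, rfl⟩

theorem dist_toGlueL_toGlueR (x : X) (y : Y) :
    dist (toGlueL hΦ hΨ x) (toGlueR hΦ hΨ y) = ⨅ p, dist x (Φ p) + dist y (Ψ p) :=
  add_zero _

theorem glue_univ : (univ : Set (GlueSpace hΦ hΨ)) =
    range (toGlueL hΦ hΨ) ∪ range (toGlueR hΦ hΨ) :=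
  (eq_univ_of_forall fun g => glue_cases hΦ hΨ g).symm

theorem glue_complete [CompleteSpace X] [CompleteSpace Y] : CompleteSpace (GlueSpace hΦ hΨ) := by
  rw [completeSpace_iff_isComplete_univ, glue_univ]
  exact (toGlueL_isometry hΦ hΨ).isUniformInducing.isComplete_range.union
    (toGlueR_isometry hΦ hΨ).isUniformInducing.isComplete_range

theorem glue_separable [SeparableSpace X] [SeparableSpace Y] :
    SeparableSpace (GlueSpace hΦ hΨ) := by
  rw [← isSeparable_univ_iff, glue_univ]
  exact (isSeparable_range (toGlueL_isometry hΦ hΨ).continuous).union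
    (isSeparable_range (toGlueR_isometry hΦ hΨ).continuous)

theorem glue_compact [CompactSpace X] [CompactSpace Y] : CompactSpace (GlueSpace hΦ hΨ) := by
  rw [← isCompact_univ_iff, glue_univ]
  exact (isCompact_range (toGlueL_isometry hΦ hΨ).continuous).union
    (isCompact_range (toGlueR_isometry hΦ hΨ).continuous)

/-- `1`-Lipschitz maps that agree on the glued subspaces glue. -/
theorem glue_map {W : Type u} [MetricSpace W] (a : X → W) (b : Y → W)
    (ha : LipschitzWith 1 a) (hb : LipschitzWith 1 b) (hab : ∀ p, a (Φ p) = b (Ψ p)) :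
    ∃ m : GlueSpace hΦ hΨ → W, LipschitzWith 1 m ∧
      (∀ x, m (toGlueL hΦ hΨ x) = a x) ∧ ∀ y, m (toGlueR hΦ hΨ y) = b y := by
  have key : ∀ x y, dist (a x) (b y) ≤ dist (toGlueL hΦ hΨ x) (toGlueR hΦ hΨ y) := by
    intro x y
    rw [dist_toGlueL_toGlueR]
    refine le_ciInf fun p => (dist_triangle _ (a (Φ p)) _).trans (add_le_add ?_ ?_)
    · simpa using ha.dist_le_mul x (Φ p)
    · rw [hab, dist_comm]
      simpa using hb.dist_le_mul y (Ψ p)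
  have keyL : ∀ x x', dist (a x) (a x') ≤ dist (toGlueL hΦ hΨ x) (toGlueL hΦ hΨ x') := by
    intro x x'
    rw [(toGlueL_isometry hΦ hΨ).dist_eq]
    simpa using ha.dist_le_mul x x'
  have keyR : ∀ y y', dist (b y) (b y') ≤ dist (toGlueR hΦ hΨ y) (toGlueR hΦ hΨ y') := by
    intro y y'
    rw [(toGlueR_isometry hΦ hΨ).dist_eq]
    simpa using hb.dist_le_mul y y'
  let q : X ⊕ Y → GlueSpace hΦ hΨ := Sum.elim (toGlueL hΦ hΨ) (toGlueR hΦ hΨ)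
  let r : X ⊕ Y → W := Sum.elim a b
  have hqr : ∀ s t, dist (r s) (r t) ≤ dist (q s) (q t) := by
    rintro (x | y) (x' | y')
    · exact keyL x x'
    · exact key x y'
    · change dist (b y) (a x') ≤ dist (toGlueR hΦ hΨ y) (toGlueL hΦ hΨ x')
      rw [dist_comm, dist_comm (toGlueR hΦ hΨ y)]
      exact key x' y
    · exact keyR y y'
  have hq : Function.Surjective q := by
    intro g
    rcases glue_cases hΦ hΨ g with ⟨x, hx⟩ | ⟨y, hy⟩
    · exact ⟨Sum.inl x, hx⟩
    · exact ⟨Sum.inr y, hy⟩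
  have hm : ∀ s, r (Function.surjInv hq (q s)) = r s := by
    intro s
    have h := hqr (Function.surjInv hq (q s)) s
    rw [Function.surjInv_eq hq, dist_self] at h
    exact dist_le_zero.1 h
  refine ⟨fun g => r (Function.surjInv hq g), LipschitzWith.of_dist_le_mul fun g g' => ?_,
    fun x => hm (Sum.inl x), fun y => hm (Sum.inr y)⟩
  have h := hqr (Function.surjInv hq g) (Function.surjInv hq g')
  rw [Function.surjInv_eq hq, Function.surjInv_eq hq] at h
  simpa using h

end Glue

/-- Two compact fields that contain a common compact field can be glued along it. -/
theorem exists_glue {Y Z₁ Z₂ : CompactField.{u}}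
    (Ψ₁ : FieldEmbedding Y.toPolishField Z₁.toPolishField)
    (Ψ₂ : FieldEmbedding Y.toPolishField Z₂.toPolishField) :
    ∃ (Z : CompactField.{u}) (L : FieldEmbedding Z₁.toPolishField Z.toPolishField)
      (R : FieldEmbedding Z₂.toPolishField Z.toPolishField),
      L.onDom ∘ Ψ₁.onDom = R.onDom ∘ Ψ₂.onDom := by
  have : Nonempty Y.cod := Y.nonemptyDom.map Y.map
  have hf₁ := Ψ₁.isometry_onDom
  have hf₂ := Ψ₂.isometry_onDom
  have hg₁ := Ψ₁.isometry_onCod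
  have hg₂ := Ψ₂.isometry_onCod
  have := glue_complete hf₁ hf₂
  have := glue_separable hf₁ hf₂
  have := glue_compact hf₁ hf₂
  have := glue_complete hg₁ hg₂
  have := glue_separable hg₁ hg₂
  have : Nonempty (GlueSpace hf₁ hf₂) := Z₁.nonemptyDom.map (toGlueL hf₁ hf₂)
  obtain ⟨m, hm, hmL, hmR⟩ := glue_map hf₁ hf₂ (toGlueL hg₁ hg₂ ∘ Z₁.map)
    (toGlueR hg₁ hg₂ ∘ Z₂.map)
    (by simpa using (toGlueL_isometry hg₁ hg₂).lipschitz.comp Z₁.lipschitz)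
    (by simpa using (toGlueR_isometry hg₁ hg₂).lipschitz.comp Z₂.lipschitz)
    (fun p => by
      simp only [Function.comp_apply, Ψ₁.comm, Ψ₂.comm]
      exact congrFun (toGlue_commute hg₁ hg₂) (Y.map p))
  refine ⟨{ dom := GlueSpace hf₁ hf₂, cod := GlueSpace hg₁ hg₂, map := m, lipschitz := hm },
    ⟨toGlueL hf₁ hf₂, toGlueL hg₁ hg₂, toGlueL_isometry hf₁ hf₂, toGlueL_isometry hg₁ hg₂, hmL⟩,
    ⟨toGlueR hf₁ hf₂, toGlueR hg₁ hg₂, toGlueR_isometry hf₁ hf₂, toGlueR_isometry hg₁ hg₂, hmR⟩,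
    toGlue_commute hf₁ hf₂⟩

theorem ghEDist_triangle (X Y W : CompactField.{u}) :
    ghEDist X W ≤ ghEDist X Y + ghEDist Y W := by
  refine ENNReal.le_of_forall_pos_le_add fun ε hε hfin => ?_
  have hε' : (0 : ℝ≥0∞) < ε / 2 := by simpa using hε.ne'
  have h1 : ghEDist X Y < ghEDist X Y + ε / 2 :=
    ENNReal.lt_add_right (ne_top_of_le_ne_top hfin.ne le_self_add) hε'.ne'
  have h2 : ghEDist Y W < ghEDist Y W + ε / 2 :=
    ENNReal.lt_add_right (ne_top_of_le_ne_top hfin.ne le_add_self) hε'.ne'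
  conv_lhs at h1 => unfold ghEDist
  conv_lhs at h2 => unfold ghEDist
  simp only [iInf_lt_iff] at h1 h2
  obtain ⟨Z₁, Φ₁, Ψ₁, h1⟩ := h1
  obtain ⟨Z₂, Ψ₂, Φ₂, h2⟩ := h2
  obtain ⟨Z, L, R, hLR⟩ := exists_glue Ψ₁ Ψ₂
  refine (ghEDist_le Z (L.comp Φ₁) (R.comp Φ₂)).trans ?_
  have e1 : hausdorffEDist (range (L.onDom ∘ Φ₁.onDom)) (range (L.onDom ∘ Ψ₁.onDom)) =
      hausdorffEDist (range Φ₁.onDom) (range Ψ₁.onDom) := by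
    rw [range_comp, range_comp, hausdorffEDist_image L.isometry_onDom]
  have e2 : hausdorffEDist (range (L.onDom ∘ Ψ₁.onDom)) (range (R.onDom ∘ Φ₂.onDom)) =
      hausdorffEDist (range Ψ₂.onDom) (range Φ₂.onDom) := by
    rw [hLR, range_comp, range_comp, hausdorffEDist_image R.isometry_onDom]
  refine (hausdorffEDist_triangle (t := range (L.onDom ∘ Ψ₁.onDom))).trans ?_
  refine (add_le_add (e1.trans_le h1.le) (e2.trans_le h2.le)).trans (le_of_eq ?_)
  rw [add_add_add_comm, ENNReal.add_halves]

/-- The field `X → π(X)` obtained from a compact field by restricting its codomain to its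
image. -/
def restrictCod (X : CompactField.{u}) : CompactField.{u} where
  dom := X.dom
  cod := range X.map
  completeCod := (isCompact_range X.lipschitz.continuous).isComplete.completeSpace_coe
  map := rangeFactorization X.map
  lipschitz := fun x y => X.lipschitz x y

/-- The image of a compact field under an isometric embedding into `F`, as a compact subfield
of `F`. -/
def image {X : CompactField.{u}} {F : PolishField.{u}} (Φ : FieldEmbedding X.toPolishField F) :
    F.CompactSubfields where
  carrier := range Φ.onDom
  isCompact' := isCompact_range Φ.isometry_onDom.continuous
  nonempty' := range_nonempty _

/-- Compact fields up to isometry of fields. -/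
instance isometricSetoid : Setoid CompactField.{u} where
  r X Y := X.toPolishField.Isometric Y.toPolishField
  iseqv :=
    { refl := fun X => ⟨IsometryEquiv.refl _, IsometryEquiv.refl _, fun _ => rfl⟩
      symm := fun ⟨f, g, h⟩ => ⟨f.symm, g.symm, fun y => by
        rw [IsometryEquiv.eq_symm_apply, ← h, IsometryEquiv.apply_symm_apply]⟩
      trans := fun ⟨f, g, h⟩ ⟨f', g', h'⟩ => ⟨f.trans f', g.trans g', fun x => by
        simp [h, h']⟩ }

end CompactField

/-- The isometry classes of compact fields with arbitrary Polish codomain. -/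
def FieldClass : Type (u + 1) := Quotient CompactField.isometricSetoid.{u}

/-- The isometry class of a compact field. -/
def CompactField.fieldClass (X : CompactField.{u}) : FieldClass.{u} :=
  Quotient.mk CompactField.isometricSetoid X

/-- The Gromov–Hausdorff distance on the set of isometry classes. -/
instance : PseudoEMetricSpace FieldClass.{u} where
  edist a b := Quotient.liftOn₂ a b CompactField.ghEDist (by
    have key : ∀ X X' Y Y' : CompactField.{u}, X.toPolishField.Isometric X'.toPolishField →
        Y.toPolishField.Isometric Y'.toPolishField →
        CompactField.ghEDist X' Y' ≤ CompactField.ghEDist X Y := by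
      intro X X' Y Y' h h'
      calc CompactField.ghEDist X' Y'
          ≤ CompactField.ghEDist X' X + (CompactField.ghEDist X Y + CompactField.ghEDist Y Y') :=
            (CompactField.ghEDist_triangle _ X _).trans
              (add_le_add le_rfl (CompactField.ghEDist_triangle _ Y _))
        _ = CompactField.ghEDist X Y := by
            rw [CompactField.ghEDist_comm X' X, CompactField.ghEDist_eq_zero_of_isometric h,
              CompactField.ghEDist_eq_zero_of_isometric h', zero_add, add_zero]
    intro X Y X' Y' h h'
    exact le_antisymm (key _ _ _ _ (Setoid.symm h) (Setoid.symm h')) (key _ _ _ _ h h'))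
  edist_self a := by
    induction a using Quotient.inductionOn with | _ X
    exact CompactField.ghEDist_eq_zero_of_isometric (Setoid.refl X)
  edist_comm a b := by
    induction a, b using Quotient.inductionOn₂ with | _ X Y
    exact CompactField.ghEDist_comm X Y
  edist_triangle a b c := by
    induction a, b, c using Quotient.inductionOn₃ with | _ X Y W
    exact CompactField.ghEDist_triangle X Y W

/-- The moduli space of compact fields: the metric space associated with the set of isometry
classes of compact fields and the Gromov–Hausdorff distance (classes at distance `0` are
identified). -/
abbrev FieldModuli : Type (u + 1) := SeparationQuotient FieldClass.{u}

/-- The point of the moduli space that a compact field defines. -/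
def CompactField.toModuli (X : CompactField.{u}) : FieldModuli.{u} :=
  SeparationQuotient.mk X.fieldClass

theorem CompactField.edist_toModuli (X Y : CompactField.{u}) :
    edist X.toModuli Y.toModuli = X.ghEDist Y := rfl

end

/-! An ultimate Urysohn field solves one-point extension problems over finite data. Completeness
upgrades this to compact data (`exists_realization_of_isCompact`): an approximate solution with
error ε can be moved by at most ε to one with arbitrarily small error, so successive corrections
converge to an exact solution. Hence compact partial isometries extend point by point, and
back-and-forth gives universality (`nonempty_embedding`) and compact homogeneity
(`exists_aut_comp_eq`): a map between compact subsets extends to an automorphism as soon as it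
preserves distances and distances between projections.

The two distances then agree. A compact field containing X and Y embeds into 𝒰, and homogeneity
carries any given images of X and Y to those obtained this way, so the orbit distance is at most the
Gromov–Hausdorff distance. Conversely, A ∪ φ(A') is itself a compact field containing both. If two
orbits are at distance 0, an ultrafilter limit of automorphisms maps A' onto A and preserves both
kinds of distance, so homogeneity puts A and A' in one orbit. Only distances within π(X) enter, not
the rest of the codomain; this is why distance 0 means isometry after restriction of the codomains
to the images. -/

open Filter

noncomputable section

/-! ### One-point extensions: from finite to compact distance types. -/

section DistanceTypes

variable {α : Type*} [MetricSpace α]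

/-- A set of pairs (point, prescribed distance from a new point to it) that satisfies the
triangle inequalities of a one-point metric extension. -/
def IsDistanceType (G : Set (α × ℝ)) : Prop :=
  ∀ p ∈ G, ∀ q ∈ G, p.2 ≤ dist p.1 q.1 + q.2 ∧ dist p.1 q.1 ≤ p.2 + q.2

theorem IsDistanceType.nonneg {G : Set (α × ℝ)} (hG : IsDistanceType G) {p : α × ℝ}
    (hp : p ∈ G) : 0 ≤ p.2 := by
  have h := (hG p hp p hp).2
  rw [dist_self] at h
  linarith

/-- Treats the degenerate types, realized by a point already present; the Urysohn property speaks
only of genuinely new points. -/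
theorem IsDistanceType.eq_dist_of_eq_zero {G : Set (α × ℝ)} (hG : IsDistanceType G)
    {p q : α × ℝ} (hp : p ∈ G) (hp0 : p.2 = 0) (hq : q ∈ G) : dist p.1 q.1 = q.2 := by
  have h1 := (hG p hp q hq).2
  have h2 := (hG q hq p hp).1
  rw [dist_comm] at h2
  linarith

/-- A point that realizes a distance type up to `ε` can be moved by at most `ε` to a point
that realizes it up to any prescribed precision, provided finite distance types are
realizable. -/
theorem exists_better_approx {S : Set α} {c : α → ℝ} (hc0 : ∀ a ∈ S, c a = 0)
    (hfin : ∀ G : Set (α × ℝ), G.Finite → IsDistanceType G → (∀ p ∈ G, c p.1 ≤ p.2) →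
      ∃ a ∈ S, ∀ p ∈ G, dist a p.1 = p.2)
    {G : Set (α × ℝ)} (hGc : IsCompact G) (hne : G.Nonempty) (hG : IsDistanceType G)
    (hcG : ∀ p ∈ G, c p.1 ≤ p.2) {a : α} (ha : a ∈ S) {ε ε' : ℝ} (hε' : 0 < ε')
    (hε : ∀ p ∈ G, |dist a p.1 - p.2| ≤ ε) :
    ∃ a' ∈ S, dist a a' ≤ ε ∧ ∀ p ∈ G, |dist a' p.1 - p.2| ≤ ε' := by
  obtain ⟨p₀, hp₀, hmax⟩ := hGc.exists_isMaxOn hne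
    (f := fun p : α × ℝ => |dist a p.1 - p.2|) (by fun_prop)
  set δ := |dist a p₀.1 - p₀.2| with hδ
  have hmax : ∀ p ∈ G, |dist a p.1 - p.2| ≤ δ := fun p hp => hmax hp
  have hδ0 : 0 ≤ δ := abs_nonneg _
  obtain ⟨N, hNG, hNf, hN⟩ := hGc.finite_cover_balls (half_pos hε')
  -- The only inequality that uses that the maximal error δ is attained: it is checked by comparing
  -- p with p₀.
  have hlow : ∀ p ∈ G, δ ≤ dist a p.1 + p.2 := by
    intro p hp
    obtain ⟨h1, h2⟩ := hG p₀ hp₀ p hp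
    obtain ⟨h3, h4⟩ := hG p hp p₀ hp₀
    have h5 := dist_triangle a p.1 p₀.1
    have h6 := dist_triangle p.1 a p₀.1
    rw [dist_comm p.1 a] at h6
    rw [dist_comm p₀.1 p.1] at h1 h2
    exact abs_le.2 ⟨by linarith, by linarith⟩
  have hcross : ∀ p ∈ G, dist a p.1 ≤ δ + p.2 ∧ p.2 ≤ dist a p.1 + δ := by
    intro p hp
    have := abs_le.1 (hmax p hp)
    exact ⟨by linarith, by linarith⟩
  -- The maximal error δ is the least distance from a that a realization of G can have. Prescribing
  -- it together with the exact values on an ε'/2-net still gives a distance type. Off the net, each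
  -- of the two coordinates costs at most ε'/2.
  obtain ⟨a', ha', h'⟩ := hfin (insert (a, δ) N) (hNf.insert _) (by
      rintro p (rfl | hp) q (rfl | hq)
      · simp [hδ0]
      · exact ⟨hlow q (hNG hq), (hcross q (hNG hq)).1⟩
      · rw [dist_comm]
        exact ⟨(hcross p (hNG hp)).2, by linarith [(hcross p (hNG hp)).1]⟩
      · exact hG p (hNG hp) q (hNG hq)) (by
      rintro p (rfl | hp)
      · simpa [hc0 a ha] using hδ0
      · exact hcG p (hNG hp))
  refine ⟨a', ha', ?_, fun p hp => ?_⟩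
  · rw [dist_comm, h' (a, δ) (mem_insert _ _)]
    exact hε p₀ hp₀
  · obtain ⟨q, hq, hpq⟩ := mem_iUnion₂.1 (hN hp)
    have hq' := h' q (mem_insert_of_mem _ hq)
    rw [mem_ball, Prod.dist_eq, max_lt_iff, Real.dist_eq, abs_lt] at hpq
    have h1 := dist_triangle a' q.1 p.1
    have h2 := dist_triangle a' p.1 q.1
    rw [dist_comm q.1 p.1] at h1
    exact abs_le.2 ⟨by linarith [hpq.1, hpq.2.1], by linarith [hpq.1, hpq.2.2]⟩

/-- If finite distance types are realizable in a closed set, then so are compact ones. -/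
theorem exists_realization_of_isCompact [CompleteSpace α] {S : Set α} (hS : IsClosed S)
    {c : α → ℝ} (hc0 : ∀ a ∈ S, c a = 0)
    (hfin : ∀ G : Set (α × ℝ), G.Finite → IsDistanceType G → (∀ p ∈ G, c p.1 ≤ p.2) →
      ∃ a ∈ S, ∀ p ∈ G, dist a p.1 = p.2)
    {G : Set (α × ℝ)} (hGc : IsCompact G) (hG : IsDistanceType G)
    (hcG : ∀ p ∈ G, c p.1 ≤ p.2) : ∃ a ∈ S, ∀ p ∈ G, dist a p.1 = p.2 := by
  rcases G.eq_empty_or_nonempty with rfl | hne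
  · exact hfin ∅ finite_empty hG hcG
  obtain ⟨a₀, ha₀, -⟩ := hfin ∅ finite_empty (by simp [IsDistanceType]) (by simp)
  obtain ⟨M, hM⟩ := (hGc.image (f := fun p : α × ℝ => |dist a₀ p.1 - p.2|)
    (by fun_prop)).bddAbove
  have hM' : ∀ p ∈ G, |dist a₀ p.1 - p.2| ≤ M := fun p hp => hM (mem_image_of_mem _ hp)
  -- Each step moves the point by at most its current error, so halving errors make the sequence
  -- Cauchy. The crude bound M serves only to start.
  have pos : ∀ n : ℕ, (0 : ℝ) < 1 / 2 / 2 ^ n := fun n => by positivity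
  obtain ⟨a₁, ha₁, -, h₁⟩ := exists_better_approx hc0 hfin hGc hne hG hcG ha₀ (pos 0) hM'
  have step : ∀ (n : ℕ) (a : {a // a ∈ S ∧ ∀ p ∈ G, |dist a p.1 - p.2| ≤ 1 / 2 / 2 ^ n}),
      ∃ b : {a // a ∈ S ∧ ∀ p ∈ G, |dist a p.1 - p.2| ≤ 1 / 2 / 2 ^ (n + 1)},
        dist a.1 b.1 ≤ 1 / 2 / 2 ^ n := by
    rintro n ⟨a, ha, h⟩
    obtain ⟨b, hb, hab, h'⟩ := exists_better_approx hc0 hfin hGc hne hG hcG ha (pos (n + 1)) h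
    exact ⟨⟨b, hb, h'⟩, hab⟩
  choose next hnext using step
  let s : ∀ n, {a // a ∈ S ∧ ∀ p ∈ G, |dist a p.1 - p.2| ≤ 1 / 2 / 2 ^ n} :=
    fun n => Nat.rec ⟨a₁, ha₁, h₁⟩ next n
  have hs : ∀ n, dist (s n).1 (s (n + 1)).1 ≤ 1 / 2 / 2 ^ n := fun n => hnext n (s n)
  obtain ⟨a, ha⟩ := cauchySeq_tendsto_of_complete (cauchySeq_of_le_geometric_two hs)
  refine ⟨a, hS.mem_of_tendsto ha (Eventually.of_forall fun n => (s n).2.1), fun p hp => ?_⟩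
  have hlim : Tendsto (fun n : ℕ => (1 / 2 / 2 ^ n : ℝ)) atTop (𝓝 0) := by
    have := (tendsto_pow_atTop_nhds_zero_of_lt_one (r := (1 / 2 : ℝ)) (by norm_num)
      (by norm_num)).const_mul (1 / 2)
    simpa [div_eq_mul_inv] using this
  have h := squeeze_zero (fun n => abs_nonneg _) (fun n => (s n).2.2 p hp) hlim
  have h' : Tendsto (fun n => |dist (s n).1 p.1 - p.2|) atTop (𝓝 |dist a p.1 - p.2|) :=
    ((ha.dist tendsto_const_nhds).sub tendsto_const_nhds).abs
  exact sub_eq_zero.1 (abs_eq_zero.1 (tendsto_nhds_unique h' h))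

/-- The one-point extension of a metric space by a positive Katětov function. -/
@[reducible]
def optionMetricSpace (f : α → ℝ) (hpos : ∀ a, 0 < f a) (hf : ∀ a b, f a ≤ dist a b + f b)
    (hf' : ∀ a b, dist a b ≤ f a + f b) : MetricSpace (Option α) where
  dist
    | none, none => 0
    | none, some a => f a
    | some a, none => f a
    | some a, some b => dist a b
  dist_self x := by cases x <;> simp
  dist_comm x y := by cases x <;> cases y <;> simp [dist_comm]
  dist_triangle x y z := by
    rcases x with _ | a <;> rcases y with _ | b <;> rcases z with _ | c <;> simp only
    · simp
    · simp
    · linarith [hpos b]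
    · rw [add_comm, dist_comm]; exact hf c b
    · simp
    · exact hf' a c
    · exact hf a b
    · exact dist_triangle a b c
  eq_of_dist_eq_zero {x y} h := by
    rcases x with _ | a <;> rcases y with _ | b
    · rfl
    · exact absurd h (hpos b).ne'
    · exact absurd h (hpos a).ne'
    · exact congrArg some (eq_of_dist_eq_zero h)

/-- A finite distance type with positive distances, as a function on its set of points. -/
theorem IsDistanceType.exists_fun {G : Set (α × ℝ)} (hG : IsDistanceType G) :
    ∃ f : Prod.fst '' G → ℝ, ∀ p (hp : p ∈ G), f ⟨p.1, mem_image_of_mem _ hp⟩ = p.2 := by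
  choose q hq hqa using fun a : Prod.fst '' G => a.2
  refine ⟨fun a => (q a).2, fun p hp => ?_⟩
  have h := hqa ⟨p.1, mem_image_of_mem _ hp⟩
  have h1 := (hG _ hp _ (hq ⟨p.1, mem_image_of_mem _ hp⟩)).1
  have h2 := (hG _ (hq ⟨p.1, mem_image_of_mem _ hp⟩) _ hp).1
  simp only at h
  rw [h, dist_self] at h1 h2
  linarith

/-- The one-point extension defined by a distance type with positive distances. -/
theorem IsDistanceType.exists_metricSpace {G : Set (α × ℝ)} (hG : IsDistanceType G)
    (hpos : ∀ p ∈ G, p.2 ≠ 0) :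
    ∃ m : MetricSpace (Option (Prod.fst '' G)),
      (∀ a b : Prod.fst '' G, m.dist (some a) (some b) = dist a b) ∧
      ∀ p (hp : p ∈ G), m.dist none (some ⟨p.1, mem_image_of_mem _ hp⟩) = p.2 := by
  obtain ⟨f, hf⟩ := hG.exists_fun
  refine ⟨optionMetricSpace f ?_ ?_ ?_, fun a b => rfl, hf⟩
  · rintro ⟨_, p, hp, rfl⟩
    rw [hf p hp]
    exact lt_of_le_of_ne (hG.nonneg hp) (hpos p hp).symm
  · rintro ⟨_, p, hp, rfl⟩ ⟨_, q, hq, rfl⟩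
    rw [hf p hp, hf q hq]
    exact (hG p hp q hq).1
  · rintro ⟨_, p, hp, rfl⟩ ⟨_, q, hq, rfl⟩
    rw [hf p hp, hf q hq]
    exact (hG p hp q hq).2

end DistanceTypes

/-! ### Extension over compact sets in the codomain and in the fibres. -/

namespace PolishField

variable {𝒰 : PolishField.{u}}

theorem IsUltimateUrysohn.exists_cod_of_finite (h𝒰 : 𝒰.IsUltimateUrysohn)
    {G : Set (𝒰.cod × ℝ)} (hfin : G.Finite) (hG : IsDistanceType G) :
    ∃ z, ∀ p ∈ G, dist z p.1 = p.2 := by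
  by_cases h0 : ∃ p ∈ G, p.2 = 0
  · obtain ⟨p, hp, hp0⟩ := h0
    exact ⟨p.1, fun q hq => hG.eq_dist_of_eq_zero hp hp0 hq⟩
  push Not at h0
  obtain ⟨m, hm, hm'⟩ := hG.exists_metricSpace h0
  -- With A empty, A* is a single point; sending it to the new point of Z* imposes no condition.
  let m₀ : MetricSpace (Option (∅ : Set 𝒰.dom)) :=
    optionMetricSpace (fun _ => 1) (fun _ => one_pos) (fun a => a.2.elim) (fun a => a.2.elim)
  obtain ⟨i, j, hi, hj, -, hj', -⟩ := h𝒰 ∅ (Prod.fst '' G) finite_empty (hfin.image _)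
    (mapsTo_empty _ _) (fun _ => none) (fun a => a.2.elim)
    (Isometry.of_dist_eq fun a b => hm a b) (LipschitzWith.const' _) (fun a => a.2.elim)
  refine ⟨j none, fun p hp => ?_⟩
  rw [← hm' p hp]
  conv_lhs => rw [show p.1 = j (some ⟨p.1, mem_image_of_mem _ hp⟩) from (hj' ⟨p.1, _⟩).symm]
  exact hj.dist_eq _ _

/-- The projection of the new point can be prescribed: z is put into the finite set Z beforehand,
and the new point is sent to it. -/
theorem IsUltimateUrysohn.exists_dom_of_finite (h𝒰 : 𝒰.IsUltimateUrysohn) (z : 𝒰.cod)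
    {G : Set (𝒰.dom × ℝ)} (hfin : G.Finite) (hG : IsDistanceType G)
    (hz : ∀ p ∈ G, dist (𝒰.map p.1) z ≤ p.2) :
    ∃ a, 𝒰.map a = z ∧ ∀ p ∈ G, dist a p.1 = p.2 := by
  by_cases h0 : ∃ p ∈ G, p.2 = 0
  · obtain ⟨p, hp, hp0⟩ := h0
    exact ⟨p.1, dist_le_zero.1 (hp0 ▸ hz p hp), fun q hq => hG.eq_dist_of_eq_zero hp hp0 hq⟩
  push Not at h0
  obtain ⟨m, hm, hm'⟩ := hG.exists_metricSpace h0
  have hA : (Prod.fst '' G).Finite := hfin.image _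
  set Z := insert z (𝒰.map '' (Prod.fst '' G))
  have hZ : Z.Finite := (hA.image _).insert _
  obtain ⟨C, hC⟩ := isBounded_iff.1 hZ.isBounded
  -- The new point of Z* is a dummy outside the range of `p`. Any constant distance that is positive
  -- and at least half the diameter of Z would do.
  let m₀ : MetricSpace (Option Z) := optionMetricSpace (fun _ => max C 1)
    (fun _ => lt_max_of_lt_right one_pos) (fun a b => by linarith [dist_nonneg (x := a) (y := b)])
    (fun a b => by
      have := hC a.2 b.2
      have h1 := le_max_left C 1
      have h2 := le_max_right C 1
      rw [Subtype.dist_eq]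
      linarith)
  have hAZ : MapsTo 𝒰.map (Prod.fst '' G) Z := fun a ha => mem_insert_of_mem _ (mem_image_of_mem _ ha)
  let p : Option (Prod.fst '' G) → Option Z := fun x =>
    x.elim (some ⟨z, mem_insert _ _⟩) fun a => some ⟨𝒰.map a, hAZ a.2⟩
  have hdist : ∀ a : Prod.fst '' G, dist (p none) (p (some a)) ≤ dist (none : Option (Prod.fst '' G)) (some a) := by
    rintro ⟨_, q, hq, rfl⟩
    refine le_of_le_of_eq ?_ (hm' q hq).symm
    change dist z (𝒰.map q.1) ≤ q.2
    rw [dist_comm]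
    exact hz q hq
  have hp : LipschitzWith 1 p := by
    refine LipschitzWith.of_dist_le_mul fun x y => ?_
    rw [NNReal.coe_one, one_mul]
    rcases x with _ | a <;> rcases y with _ | b
    · simp
    · exact hdist b
    · rw [dist_comm, dist_comm (some a)]
      exact hdist a
    · refine le_of_le_of_eq ?_ (hm a b).symm
      change dist (𝒰.map a) (𝒰.map b) ≤ dist (a : 𝒰.dom) b
      simpa using 𝒰.lipschitz.dist_le_mul a b
  obtain ⟨i, j, hi, hj, hi', hj', hij⟩ := h𝒰 _ Z hA hZ hAZ p
    (Isometry.of_dist_eq fun a b => hm a b) (Isometry.of_dist_eq fun a b => rfl) hp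
    (fun a => rfl)
  refine ⟨i none, (hij none).trans (hj' _), fun q hq => ?_⟩
  rw [← hm' q hq]
  conv_lhs => rw [show q.1 = i (some ⟨q.1, mem_image_of_mem _ hq⟩) from (hi' ⟨q.1, _⟩).symm]
  exact hi.dist_eq _ _

theorem IsUltimateUrysohn.exists_cod (h𝒰 : 𝒰.IsUltimateUrysohn)
    {G : Set (𝒰.cod × ℝ)} (hGc : IsCompact G) (hG : IsDistanceType G) :
    ∃ z, ∀ p ∈ G, dist z p.1 = p.2 := by
  simpa using exists_realization_of_isCompact isClosed_univ (c := fun _ => 0)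
    (fun _ _ => rfl)
    (fun H hH hH' _ => by simpa using h𝒰.exists_cod_of_finite hH hH') hGc hG
    (fun p hp => hG.nonneg hp)

/-- The fibre over z is closed, and c = d(π(·), z) vanishes on it, so approximate realizations in
the fibre can be corrected without leaving it. -/
theorem IsUltimateUrysohn.exists_dom (h𝒰 : 𝒰.IsUltimateUrysohn) (z : 𝒰.cod)
    {G : Set (𝒰.dom × ℝ)} (hGc : IsCompact G) (hG : IsDistanceType G)
    (hz : ∀ p ∈ G, dist (𝒰.map p.1) z ≤ p.2) :
    ∃ a, 𝒰.map a = z ∧ ∀ p ∈ G, dist a p.1 = p.2 :=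
  exists_realization_of_isCompact (S := 𝒰.map ⁻¹' {z})
    (isClosed_singleton.preimage 𝒰.lipschitz.continuous) (c := fun a => dist (𝒰.map a) z)
    (fun a ha => by rw [mem_preimage, mem_singleton_iff] at ha; simp [ha])
    (fun _ hH hH' hz => h𝒰.exists_dom_of_finite z hH hH' hz) hGc hG hz

end PolishField

/-! ### Partial isometries as relations, and their extension by density. -/

section IsometricRelations

variable {α β : Type*} [MetricSpace α] [MetricSpace β]

/-- A relation between metric spaces that preserves distances. -/
def IsIsometricRel (R : Set (α × β)) : Prop :=
  ∀ p ∈ R, ∀ q ∈ R, dist p.1 q.1 = dist p.2 q.2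

theorem IsIsometricRel.swap {R : Set (α × β)} (hR : IsIsometricRel R) :
    IsIsometricRel (Prod.swap '' R) := by
  rintro _ ⟨p, hp, rfl⟩ _ ⟨q, hq, rfl⟩
  exact (hR p hp q hq).symm

theorem IsIsometricRel.insert {R : Set (α × β)} (hR : IsIsometricRel R) {a : α} {b : β}
    (h : ∀ p ∈ R, dist b p.2 = dist a p.1) : IsIsometricRel (insert (a, b) R) := by
  rintro p (rfl | hp) q (rfl | hq)
  · simp
  · exact (h q hq).symm
  · rw [dist_comm, dist_comm p.2]
    exact (h p hp).symm
  · exact hR p hp q hq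

/-- The distance type over the second projection of `R` given by the distances to `a` in the
first coordinate. -/
theorem IsIsometricRel.isDistanceType {R : Set (α × β)} (hR : IsIsometricRel R) (a : α) :
    IsDistanceType ((fun p : α × β => (p.2, dist a p.1)) '' R) := by
  rintro _ ⟨p, hp, rfl⟩ _ ⟨q, hq, rfl⟩
  simp only
  rw [← hR p hp q hq]
  have := dist_triangle a q.1 p.1
  exact ⟨by rw [dist_comm p.1]; linarith, dist_triangle_left _ _ _⟩

/-- An isometric relation with dense domain extends to an isometry into a complete space. -/
theorem IsIsometricRel.exists_isometry [CompleteSpace β] {R : Set (α × β)}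
    (hR : IsIsometricRel R) (hd : Dense (Prod.fst '' R)) :
    ∃ f : α → β, Isometry f ∧ (∀ p ∈ R, f p.1 = p.2) ∧
      ∀ x, ∀ p ∈ R, dist (f x) p.2 = dist x p.1 := by
  have key : ∀ x, ∃ y, ∀ p ∈ R, dist y p.2 = dist x p.1 := by
    intro x
    obtain ⟨s, hs, hsx⟩ := mem_closure_iff_seq_limit.1 (hd x)
    choose p hp hps using hs
    have hc : CauchySeq fun n => (p n).2 := by
      refine Metric.cauchySeq_iff.2 fun ε hε => ?_
      obtain ⟨N, hN⟩ := Metric.cauchySeq_iff.1 hsx.cauchySeq ε hε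
      refine ⟨N, fun m hm n hn => ?_⟩
      rw [← hR _ (hp m) _ (hp n), hps, hps]
      exact hN m hm n hn
    obtain ⟨y, hy⟩ := cauchySeq_tendsto_of_complete hc
    refine ⟨y, fun q hq => tendsto_nhds_unique (hy.dist tendsto_const_nhds) ?_⟩
    simp only [← hR _ (hp _) q hq, hps]
    exact hsx.dist tendsto_const_nhds
  choose f hf using key
  refine ⟨f, Isometry.of_dist_eq fun x y => ?_, fun p hp => ?_, hf⟩
  · refine eq_of_forall_dist_le fun ε hε => ?_
    obtain ⟨_, ⟨p, hp, rfl⟩, hyp⟩ := hd.exists_dist_lt y (half_pos hε)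
    have h1 := hf x p hp
    have h2 := hf y p hp
    have h3 := abs_le.1 (abs_dist_sub_le x p.1 y)
    have h4 := dist_triangle_right (f x) (f y) p.2
    have h5 := dist_triangle (f x) (f y) p.2
    have h6 := dist_triangle_right x y p.1
    have h7 := dist_triangle x y p.1
    rw [Real.dist_eq, abs_le]
    exact ⟨by linarith, by linarith⟩
  · rw [← dist_eq_zero, hf _ p hp, dist_self]

/-- An isometric relation with dense domain and range between complete spaces extends to a
bijective isometry. -/
theorem IsIsometricRel.exists_isometryEquiv [CompleteSpace α] [CompleteSpace β]
    {R : Set (α × β)} (hR : IsIsometricRel R) (hd : Dense (Prod.fst '' R))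
    (hd' : Dense (Prod.snd '' R)) : ∃ f : α ≃ᵢ β, ∀ p ∈ R, f p.1 = p.2 := by
  obtain ⟨f, hf, hfR, hf'⟩ := hR.exists_isometry hd
  obtain ⟨g, hg, hgR, hg'⟩ := hR.swap.exists_isometry (by
    rwa [image_image])
  -- Both points have the same distances to the dense second projection of R.
  have hfg : ∀ y, f (g y) = y := by
    intro y
    refine eq_of_forall_dist_le fun ε hε => ?_
    obtain ⟨_, ⟨p, hp, rfl⟩, hyp⟩ := hd'.exists_dist_lt y (half_pos hε)
    have h1 := hf' (g y) p hp
    have h2 : dist (g y) p.1 = dist y p.2 := hg' y _ (mem_image_of_mem _ hp)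
    have h3 := dist_triangle_right (f (g y)) y p.2
    linarith
  exact ⟨IsometryEquiv.mk' f g hfg hf, hfR⟩

end IsometricRelations

/-! ### Compact partial isometries of fields and their one-point extensions. -/

/-- A compact partial isometry between fields. -/
structure PartialFieldIso (X Y : PolishField.{u}) where
  onDom : Set (X.dom × Y.dom)
  onCod : Set (X.cod × Y.cod)
  isCompact_onDom : IsCompact onDom
  isCompact_onCod : IsCompact onCod
  isometric_onDom : IsIsometricRel onDom
  isometric_onCod : IsIsometricRel onCod
  comm : ∀ p ∈ onDom, (X.map p.1, Y.map p.2) ∈ onCod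

namespace PartialFieldIso

variable {X Y : PolishField.{u}}

instance : Preorder (PartialFieldIso X Y) := Preorder.lift fun P => (P.onDom, P.onCod)

instance : Inhabited (PartialFieldIso X Y) :=
  ⟨∅, ∅, isCompact_empty, isCompact_empty, by simp [IsIsometricRel], by simp [IsIsometricRel],
    by simp⟩

/-- The inverse partial isometry. -/
def swap (P : PartialFieldIso X Y) : PartialFieldIso Y X where
  onDom := Prod.swap '' P.onDom
  onCod := Prod.swap '' P.onCod
  isCompact_onDom := P.isCompact_onDom.image continuous_swap
  isCompact_onCod := P.isCompact_onCod.image continuous_swap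
  isometric_onDom := P.isometric_onDom.swap
  isometric_onCod := P.isometric_onCod.swap
  comm := by
    rintro _ ⟨p, hp, rfl⟩
    exact ⟨_, P.comm p hp, rfl⟩

theorem le_swap {P : PartialFieldIso X Y} {Q : PartialFieldIso Y X} (h : P.swap ≤ Q) :
    P ≤ Q.swap :=
  ⟨fun p hp => ⟨p.swap, h.1 (mem_image_of_mem _ hp), p.swap_swap⟩,
    fun p hp => ⟨p.swap, h.2 (mem_image_of_mem _ hp), p.swap_swap⟩⟩

theorem exists_extend_cod (hY : Y.IsUltimateUrysohn) (P : PartialFieldIso X Y) (z : X.cod) :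
    ∃ Q, (∃ z', (z, z') ∈ Q.onCod) ∧ P ≤ Q := by
  obtain ⟨z', hz'⟩ := hY.exists_cod
    (P.isCompact_onCod.image (f := fun p => (p.2, dist z p.1)) (by fun_prop))
    (P.isometric_onCod.isDistanceType z)
  refine ⟨⟨P.onDom, insert (z, z') P.onCod, P.isCompact_onDom, P.isCompact_onCod.insert _,
    P.isometric_onDom, P.isometric_onCod.insert fun p hp => hz' _ (mem_image_of_mem _ hp),
    fun p hp => mem_insert_of_mem _ (P.comm p hp)⟩, ⟨z', mem_insert _ _⟩, Subset.rfl,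
    subset_insert _ _⟩

/-- The projection of x is matched with some z' before x itself, whose partner is then sought in the
fibre over z'. The required lower bound on distances is the Lipschitz property of X, transported by
the isometric relation on the codomains. -/
theorem exists_extend_dom (hY : Y.IsUltimateUrysohn) (P : PartialFieldIso X Y) (x : X.dom) :
    ∃ Q, (∃ x', (x, x') ∈ Q.onDom) ∧ P ≤ Q := by
  obtain ⟨Q, ⟨z', hz'⟩, hPQ⟩ := exists_extend_cod hY P (X.map x)
  obtain ⟨x', hxz, hx'⟩ := hY.exists_dom z'
    (Q.isCompact_onDom.image (f := fun p => (p.2, dist x p.1)) (by fun_prop))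
    (Q.isometric_onDom.isDistanceType x) (by
      rintro _ ⟨p, hp, rfl⟩
      simp only
      rw [← Q.isometric_onCod _ (Q.comm p hp) _ hz', dist_comm]
      simpa using X.lipschitz.dist_le_mul x p.1)
  refine ⟨⟨insert (x, x') Q.onDom, Q.onCod, Q.isCompact_onDom.insert _, Q.isCompact_onCod,
    Q.isometric_onDom.insert fun p hp => hx' _ (mem_image_of_mem _ hp), Q.isometric_onCod, ?_⟩,
    ⟨x', mem_insert _ _⟩, hPQ.1.trans (subset_insert _ _), hPQ.2⟩
  rintro p (rfl | hp)
  · rwa [hxz]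
  · exact Q.comm p hp

theorem isCofinal_dom (hY : Y.IsUltimateUrysohn) (x : X.dom) :
    IsCofinal {P : PartialFieldIso X Y | ∃ x', (x, x') ∈ P.onDom} :=
  fun P => exists_extend_dom hY P x

theorem isCofinal_cod (hY : Y.IsUltimateUrysohn) (z : X.cod) :
    IsCofinal {P : PartialFieldIso X Y | ∃ z', (z, z') ∈ P.onCod} :=
  fun P => exists_extend_cod hY P z

theorem isCofinal_ran_dom (hX : X.IsUltimateUrysohn) (y : Y.dom) :
    IsCofinal {P : PartialFieldIso X Y | ∃ x, (x, y) ∈ P.onDom} := fun P => by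
  obtain ⟨Q, ⟨x, hx⟩, h⟩ := exists_extend_dom hX P.swap y
  exact ⟨Q.swap, ⟨x, _, hx, rfl⟩, le_swap h⟩

theorem isCofinal_ran_cod (hX : X.IsUltimateUrysohn) (z : Y.cod) :
    IsCofinal {P : PartialFieldIso X Y | ∃ z', (z', z) ∈ P.onCod} := fun P => by
  obtain ⟨Q, ⟨x, hx⟩, h⟩ := exists_extend_cod hX P.swap z
  exact ⟨Q.swap, ⟨x, _, hx, rfl⟩, le_swap h⟩

/-- The union of a directed family of partial isometries that meets countably many cofinal
sets. -/
theorem exists_union (P₀ : PartialFieldIso X Y) {ι : Type*} [Countable ι]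
    (D : ι → Set (PartialFieldIso X Y)) (hD : ∀ i, IsCofinal (D i)) :
    ∃ (R : Set (X.dom × Y.dom)) (Q : Set (X.cod × Y.cod)), IsIsometricRel R ∧
      IsIsometricRel Q ∧ (∀ p ∈ R, (X.map p.1, Y.map p.2) ∈ Q) ∧ P₀.onDom ⊆ R ∧
      ∀ i, ∃ P ∈ D i, P.onDom ⊆ R ∧ P.onCod ⊆ Q := by
  have := Encodable.ofCountable ι
  let 𝒟 : ι → Order.Cofinal (PartialFieldIso X Y) := fun i => ⟨D i, hD i⟩
  -- Rasiowa–Sikorski lemma: a directed family through P₀ that meets every `D i`. Directedness puts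
  -- any two pairs of the union into one partial isometry.
  let I := Order.idealOfCofinals P₀ 𝒟
  refine ⟨⋃ P ∈ I, P.onDom, ⋃ P ∈ I, P.onCod, ?_, ?_, ?_, ?_, fun i => ?_⟩
  · intro p hp q hq
    obtain ⟨P, hP, hp⟩ := mem_iUnion₂.1 hp
    obtain ⟨Q, hQ, hq⟩ := mem_iUnion₂.1 hq
    obtain ⟨T, -, hPT, hQT⟩ := I.directed P hP Q hQ
    exact T.isometric_onDom p (hPT.1 hp) q (hQT.1 hq)
  · intro p hp q hq
    obtain ⟨P, hP, hp⟩ := mem_iUnion₂.1 hp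
    obtain ⟨Q, hQ, hq⟩ := mem_iUnion₂.1 hq
    obtain ⟨T, -, hPT, hQT⟩ := I.directed P hP Q hQ
    exact T.isometric_onCod p (hPT.2 hp) q (hQT.2 hq)
  · intro p hp
    obtain ⟨P, hP, hp⟩ := mem_iUnion₂.1 hp
    exact mem_iUnion₂.2 ⟨P, hP, P.comm p hp⟩
  · exact fun p hp => mem_iUnion₂.2 ⟨P₀, Order.mem_idealOfCofinals P₀ 𝒟, hp⟩
  · obtain ⟨P, hP, hPI⟩ := Order.cofinal_meets_idealOfCofinals P₀ 𝒟 i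
    exact ⟨P, hP, fun p hp => mem_iUnion₂.2 ⟨P, hPI, hp⟩, fun p hp => mem_iUnion₂.2 ⟨P, hPI, hp⟩⟩

end PartialFieldIso

/-! ### Universality and compact homogeneity. -/

namespace PolishField

variable {𝒰 : PolishField.{u}}

/-- Every field embeds into an ultimate Urysohn field. -/
theorem IsUltimateUrysohn.nonempty_embedding (h𝒰 : 𝒰.IsUltimateUrysohn) (X : PolishField.{u}) :
    Nonempty (FieldEmbedding X 𝒰) := by
  obtain ⟨s, hs, hsd⟩ := exists_countable_dense X.dom
  obtain ⟨t, ht, htd⟩ := exists_countable_dense X.cod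
  have := hs.to_subtype
  have := ht.to_subtype
  -- Only the "forth" half: dense sets of X exhaust the source, starting from the empty partial
  -- isometry.
  obtain ⟨R, Q, hR, hQ, hRQ, -, h⟩ := PartialFieldIso.exists_union (default : PartialFieldIso X 𝒰)
    (ι := s ⊕ t) (Sum.elim (fun x => {P | ∃ x', (x.1, x') ∈ P.onDom})
      (fun z => {P | ∃ z', (z.1, z') ∈ P.onCod}))
    (by
      rintro (x | z)
      · exact PartialFieldIso.isCofinal_dom h𝒰 x.1
      · exact PartialFieldIso.isCofinal_cod h𝒰 z.1)
  have hRd : Dense (Prod.fst '' R) := hsd.mono fun x hx => by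
    obtain ⟨P, ⟨x', hx'⟩, hP, -⟩ := h (Sum.inl ⟨x, hx⟩)
    exact ⟨_, hP hx', rfl⟩
  have hQd : Dense (Prod.fst '' Q) := htd.mono fun z hz => by
    obtain ⟨P, ⟨z', hz'⟩, -, hP⟩ := h (Sum.inr ⟨z, hz⟩)
    exact ⟨_, hP hz', rfl⟩
  obtain ⟨f, hf, hfR, -⟩ := hR.exists_isometry hRd
  obtain ⟨g, hg, hgQ, -⟩ := hQ.exists_isometry hQd
  refine ⟨⟨f, g, hf, hg, congrFun (Continuous.ext_on hRd
    (𝒰.lipschitz.continuous.comp hf.continuous) (hg.continuous.comp X.lipschitz.continuous) ?_)⟩⟩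
  rintro _ ⟨p, hp, rfl⟩
  simp only
  rw [hfR p hp, hgQ _ (hRQ p hp)]

/-- Compact partial isometries of an ultimate Urysohn field extend to automorphisms. -/
theorem IsUltimateUrysohn.exists_aut_extending (h𝒰 : 𝒰.IsUltimateUrysohn)
    (P₀ : PartialFieldIso 𝒰 𝒰) : ∃ g : 𝒰.Aut, ∀ p ∈ P₀.onDom, g.1.1 p.1 = p.2 := by
  obtain ⟨s, hs, hsd⟩ := exists_countable_dense 𝒰.dom
  obtain ⟨t, ht, htd⟩ := exists_countable_dense 𝒰.cod
  have := hs.to_subtype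
  have := ht.to_subtype
  obtain ⟨R, Q, hR, hQ, hRQ, hP₀, h⟩ := P₀.exists_union
    (ι := (s ⊕ t) ⊕ (s ⊕ t)) (Sum.elim
      (Sum.elim (fun x => {P | ∃ x', (x.1, x') ∈ P.onDom}) (fun z => {P | ∃ z', (z.1, z') ∈ P.onCod}))
      (Sum.elim (fun x => {P | ∃ x', (x', x.1) ∈ P.onDom})
        (fun z => {P | ∃ z', (z', z.1) ∈ P.onCod})))
    (by
      rintro ((x | z) | (x | z))
      · exact PartialFieldIso.isCofinal_dom h𝒰 x.1
      · exact PartialFieldIso.isCofinal_cod h𝒰 z.1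
      · exact PartialFieldIso.isCofinal_ran_dom h𝒰 x.1
      · exact PartialFieldIso.isCofinal_ran_cod h𝒰 z.1)
  have hRd : Dense (Prod.fst '' R) := hsd.mono fun x hx => by
    obtain ⟨P, ⟨x', hx'⟩, hP, -⟩ := h (Sum.inl (Sum.inl ⟨x, hx⟩))
    exact ⟨_, hP hx', rfl⟩
  have hQd : Dense (Prod.fst '' Q) := htd.mono fun z hz => by
    obtain ⟨P, ⟨z', hz'⟩, -, hP⟩ := h (Sum.inl (Sum.inr ⟨z, hz⟩))
    exact ⟨_, hP hz', rfl⟩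
  have hRd' : Dense (Prod.snd '' R) := hsd.mono fun x hx => by
    obtain ⟨P, ⟨x', hx'⟩, hP, -⟩ := h (Sum.inr (Sum.inl ⟨x, hx⟩))
    exact ⟨_, hP hx', rfl⟩
  have hQd' : Dense (Prod.snd '' Q) := htd.mono fun z hz => by
    obtain ⟨P, ⟨z', hz'⟩, -, hP⟩ := h (Sum.inr (Sum.inr ⟨z, hz⟩))
    exact ⟨_, hP hz', rfl⟩
  obtain ⟨f, hfR⟩ := hR.exists_isometryEquiv hRd hRd'
  obtain ⟨g, hgQ⟩ := hQ.exists_isometryEquiv hQd hQd'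
  refine ⟨⟨(f, g), congrFun (Continuous.ext_on hRd (𝒰.lipschitz.continuous.comp f.continuous)
    (g.continuous.comp 𝒰.lipschitz.continuous) ?_)⟩, fun p hp => hfR p (hP₀ hp)⟩
  rintro _ ⟨p, hp, rfl⟩
  simp only
  rw [hfR p hp, hgQ _ (hRQ p hp)]

/-- Compact homogeneity of ultimate Urysohn fields. -/
theorem IsUltimateUrysohn.exists_aut_comp_eq (h𝒰 : 𝒰.IsUltimateUrysohn) {K : Type*}
    [TopologicalSpace K] [CompactSpace K] {a b : K → 𝒰.dom} (ha : Continuous a)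
    (hb : Continuous b) (hab : ∀ x y, dist (a x) (a y) = dist (b x) (b y))
    (hπ : ∀ x y, dist (𝒰.map (a x)) (𝒰.map (a y)) = dist (𝒰.map (b x)) (𝒰.map (b y))) :
    ∃ g : 𝒰.Aut, ∀ x, g.1.1 (a x) = b x := by
  have hc := 𝒰.lipschitz.continuous
  -- The automorphism must also act on the codomain; `hπ` makes π(a(x)) ↦ π(b(x)) an isometric
  -- relation.
  obtain ⟨g, hg⟩ := h𝒰.exists_aut_extending
    ⟨range fun x => (a x, b x), range fun x => (𝒰.map (a x), 𝒰.map (b x)),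
      isCompact_range (by fun_prop), isCompact_range (by fun_prop),
      by rintro _ ⟨x, rfl⟩ _ ⟨y, rfl⟩; exact hab x y,
      by rintro _ ⟨x, rfl⟩ _ ⟨y, rfl⟩; exact hπ x y,
      by rintro _ ⟨x, rfl⟩; exact ⟨x, rfl⟩⟩
  exact ⟨g, fun x => hg _ ⟨x, rfl⟩⟩

end PolishField

/-! ### Orbits at distance zero coincide; compact subfields as fields. -/

namespace PolishField

variable {𝒰 : PolishField.{u}}

/-- Compact subfields of an ultimate Urysohn field whose orbits are at distance `0` lie in the
same orbit. -/
theorem IsUltimateUrysohn.exists_smul_eq_of_orbitEDist_eq_zero (h𝒰 : 𝒰.IsUltimateUrysohn)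
    {A A' : 𝒰.CompactSubfields} (h : 𝒰.orbitEDist A A' = 0) : ∃ g : 𝒰.Aut, g • A' = A := by
  obtain ⟨ε, -, hε, hεlim⟩ := exists_seq_strictAnti_tendsto' (zero_lt_one' ℝ≥0∞)
  have hex : ∀ n, ∃ g : 𝒰.Aut, hausdorffEDist (A : Set 𝒰.dom) (g.1.1 '' A') < ε n := fun n =>
    iInf_lt_iff.1 (lt_of_eq_of_lt h (hε n).1)
  choose g hg using hex
  -- Along a nonprincipal ultrafilter, g n y converges for all y in A' at once, without a diagonal
  -- argument.
  have hle : (hyperfilter ℕ : Filter ℕ) ≤ atTop := by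
    rw [← Nat.cofinite_eq_atTop]
    exact hyperfilter_le_cofinite
  have hlim : Tendsto ε (hyperfilter ℕ) (𝓝 0) := hεlim.mono_left hle
  have hF : ∀ y : (A' : Set 𝒰.dom), ∃ x ∈ A,
      Tendsto (fun n => (g n).1.1 y) (hyperfilter ℕ) (𝓝 x) := by
    intro y
    have : ∀ n, ∃ x ∈ (A : Set 𝒰.dom), edist ((g n).1.1 y) x < ε n := fun n =>
      exists_edist_lt_of_hausdorffEDist_lt (mem_image_of_mem _ y.2)
        (by rw [hausdorffEDist_comm]; exact hg n)
    choose x hx hxy using this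
    obtain ⟨x', hx', hlim'⟩ := A.isCompact.ultrafilter_le_nhds'
      ((hyperfilter ℕ).map x) (Filter.mem_map.2 (univ_mem' hx))
    refine ⟨x', hx', tendsto_iff_edist_tendsto_0.2 ?_⟩
    have h2 : Tendsto (fun n => edist (x n) x') (hyperfilter ℕ) (𝓝 0) :=
      tendsto_iff_edist_tendsto_0.1 hlim'
    refine tendsto_of_tendsto_of_tendsto_of_le_of_le tendsto_const_nhds
      (by simpa using hlim.add h2) (fun _ => bot_le) fun n => ?_
    exact (edist_triangle _ (x n) _).trans (add_le_add (hxy n).le le_rfl)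
  choose F hFA hFlim using hF
  have hFdist : ∀ y y' : (A' : Set 𝒰.dom), dist (y : 𝒰.dom) y' = dist (F y) (F y') := fun y y' =>
    tendsto_nhds_unique (by simp only [(IsometryEquiv.isometry _).dist_eq]; exact tendsto_const_nhds)
      ((hFlim y).dist (hFlim y'))
  have hπ := 𝒰.lipschitz.continuous
  -- Each g n is isometric on the codomain as well, so distances between projections survive in the
  -- limit.
  have hFmap : ∀ y y' : (A' : Set 𝒰.dom),
      dist (𝒰.map y) (𝒰.map y') = dist (𝒰.map (F y)) (𝒰.map (F y')) := fun y y' => by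
    refine tendsto_nhds_unique ?_
      (((hπ.tendsto _).comp (hFlim y)).dist ((hπ.tendsto _).comp (hFlim y')))
    have hcomm : ∀ n x, 𝒰.map ((g n).1.1 x) = (g n).1.2 (𝒰.map x) := fun n => (g n).2
    simp only [Function.comp_apply, hcomm, (IsometryEquiv.isometry _).dist_eq]
    exact tendsto_const_nhds
  -- A preimage is the ultralimit of points y n of A' with g n (y n) close to x.
  have hFsurj : ∀ x ∈ A, ∃ y, F y = x := by
    intro x hx
    have : ∀ n, ∃ y ∈ (A' : Set 𝒰.dom), edist x ((g n).1.1 y) < ε n := fun n => by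
      obtain ⟨_, ⟨y, hy, rfl⟩, h⟩ := exists_edist_lt_of_hausdorffEDist_lt hx (hg n)
      exact ⟨y, hy, h⟩
    choose y hy hxy using this
    obtain ⟨y', hy', hlim'⟩ := A'.isCompact.ultrafilter_le_nhds'
      ((hyperfilter ℕ).map y) (Filter.mem_map.2 (univ_mem' hy))
    refine ⟨⟨y', hy'⟩, tendsto_nhds_unique (hFlim ⟨y', hy'⟩) (tendsto_iff_edist_tendsto_0.2 ?_)⟩
    have h2 : Tendsto (fun n => edist (y n) y') (hyperfilter ℕ) (𝓝 0) :=
      tendsto_iff_edist_tendsto_0.1 hlim'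
    refine tendsto_of_tendsto_of_tendsto_of_le_of_le tendsto_const_nhds
      (by simpa using h2.add hlim) (fun _ => bot_le) fun n => ?_
    refine (edist_triangle _ ((g n).1.1 (y n)) _).trans (add_le_add ?_ ?_)
    · rw [IsometryEquiv.edist_eq, edist_comm]
    · rw [edist_comm]
      exact (hxy n).le
  have : CompactSpace (A' : Set 𝒰.dom) := isCompact_iff_compactSpace.1 A'.isCompact
  obtain ⟨α, hα⟩ := h𝒰.exists_aut_comp_eq continuous_subtype_val
    (Isometry.of_dist_eq fun y y' => (hFdist y y').symm).continuous hFdist hFmap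
  refine ⟨α, NonemptyCompacts.ext ?_⟩
  rw [coe_smul]
  ext x
  constructor
  · rintro ⟨y, hy, rfl⟩
    rw [hα ⟨y, hy⟩]
    exact hFA _
  · intro hx
    obtain ⟨y, rfl⟩ := hFsurj x hx
    exact ⟨y, y.2, hα y⟩

theorem IsUltimateUrysohn.eq_of_edist_orbit_eq_zero (h𝒰 : 𝒰.IsUltimateUrysohn)
    {a b : 𝒰.SubfieldOrbits} (h : edist a b = 0) : a = b := by
  induction a, b using Quotient.inductionOn₂ with | _ A A'
  exact Quotient.sound (h𝒰.exists_smul_eq_of_orbitEDist_eq_zero h)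

/-- A compact subset of the domain of `F`, as a compact field with the codomain of `F`. -/
def CompactSubfields.toField {F : PolishField.{u}} (A : F.CompactSubfields) :
    CompactField.{u} where
  dom := (A : Set F.dom)
  cod := F.cod
  completeDom := A.isCompact.isComplete.completeSpace_coe
  map x := F.map x
  lipschitz x y := F.lipschitz x y
  compactDom := isCompact_iff_compactSpace.1 A.isCompact
  nonemptyDom := A.nonempty.to_subtype

/-- The inclusion of a compact subfield. -/
def CompactSubfields.incl {F : PolishField.{u}} (A : F.CompactSubfields) :
    FieldEmbedding (toField A).toPolishField F where
  onDom := Subtype.val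
  onCod := id
  isometry_onDom := isometry_subtype_coe
  isometry_onCod := isometry_id
  comm _ := rfl

theorem CompactSubfields.image_incl {F : PolishField.{u}} (A : F.CompactSubfields) :
    CompactField.image (incl A) = A :=
  NonemptyCompacts.ext Subtype.range_coe

/-- An embedding into `F` with values in a compact subfield of `F`, as an embedding into that
subfield. -/
def CompactSubfields.codRestrict {F X : PolishField.{u}} (A : F.CompactSubfields)
    (Φ : FieldEmbedding X F) (h : ∀ x, Φ.onDom x ∈ (A : Set F.dom)) :
    FieldEmbedding X (toField A).toPolishField where
  onDom x := ⟨Φ.onDom x, h x⟩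
  onCod := Φ.onCod
  isometry_onDom x y := Φ.isometry_onDom x y
  isometry_onCod := Φ.isometry_onCod
  comm := Φ.comm

/-- An automorphism as an embedding. -/
def autEmbedding {F : PolishField.{u}} (g : F.Aut) : FieldEmbedding F F where
  onDom := g.1.1
  onCod := g.1.2
  isometry_onDom := g.1.1.isometry
  isometry_onCod := g.1.2.isometry
  comm := g.2

end PolishField

namespace FieldEmbedding

variable {X F : PolishField.{u}}

theorem dist_map (Φ : FieldEmbedding X F) (x y : X.dom) :
    dist (F.map (Φ.onDom x)) (F.map (Φ.onDom y)) = dist (X.map x) (X.map y) := by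
  rw [Φ.comm, Φ.comm, Φ.isometry_onCod.dist_eq]

end FieldEmbedding

/-! ### The Gromov–Hausdorff distance equals the orbit distance. -/

namespace CompactField

open PolishField

variable {𝒰 : PolishField.{u}}

theorem exists_aut_comp_embedding (h𝒰 : 𝒰.IsUltimateUrysohn) {X : CompactField.{u}}
    (Φ Ψ : FieldEmbedding X.toPolishField 𝒰) :
    ∃ g : 𝒰.Aut, ∀ x, g.1.1 (Φ.onDom x) = Ψ.onDom x :=
  h𝒰.exists_aut_comp_eq Φ.isometry_onDom.continuous Ψ.isometry_onDom.continuous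
    (fun x y => by rw [Φ.isometry_onDom.dist_eq, Ψ.isometry_onDom.dist_eq])
    (fun x y => by rw [Φ.dist_map, Ψ.dist_map])

theorem exists_aut_smul_image (h𝒰 : 𝒰.IsUltimateUrysohn) {X : CompactField.{u}}
    (Φ Ψ : FieldEmbedding X.toPolishField 𝒰) : ∃ g : 𝒰.Aut, g • image Φ = image Ψ := by
  obtain ⟨g, hg⟩ := exists_aut_comp_embedding h𝒰 Φ Ψ
  refine ⟨g, NonemptyCompacts.ext ?_⟩
  rw [coe_smul]
  change g.1.1 '' range Φ.onDom = range Ψ.onDom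
  rw [← range_comp]
  exact congrArg range (funext hg)

/-- A common field Z embeds into 𝒰 by universality, and homogeneity moves the images of Φ and Ψ,
each within its orbit, to the images obtained through Z. -/
theorem edist_orbit_image_le (h𝒰 : 𝒰.IsUltimateUrysohn) {X Y : CompactField.{u}}
    (Φ : FieldEmbedding X.toPolishField 𝒰) (Ψ : FieldEmbedding Y.toPolishField 𝒰) :
    𝒰.orbitEDist (image Φ) (image Ψ) ≤ X.ghEDist Y := by
  refine le_iInf fun Z => le_iInf fun Φ' => le_iInf fun Ψ' => ?_
  obtain ⟨Θ⟩ := h𝒰.nonempty_embedding Z.toPolishField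
  obtain ⟨g, hg⟩ := exists_aut_smul_image h𝒰 Φ (Θ.comp Φ')
  obtain ⟨h, hh⟩ := exists_aut_smul_image h𝒰 Ψ (Θ.comp Ψ')
  rw [← 𝒰.orbitEDist_smul_left g, ← 𝒰.orbitEDist_smul_right h, hg, hh]
  refine (iInf_le _ 1).trans ?_
  rw [one_smul]
  change hausdorffEDist (range (Θ.onDom ∘ Φ'.onDom)) (range (Θ.onDom ∘ Ψ'.onDom)) ≤ _
  rw [range_comp, range_comp, hausdorffEDist_image Θ.isometry_onDom]

/-- The union of the image of X and the translated image of Y, with the whole codomain of 𝒰, is an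
admissible common field. -/
theorem ghEDist_le_orbitEDist {X Y : CompactField.{u}}
    (Φ : FieldEmbedding X.toPolishField 𝒰) (Ψ : FieldEmbedding Y.toPolishField 𝒰) :
    X.ghEDist Y ≤ 𝒰.orbitEDist (image Φ) (image Ψ) := by
  refine le_iInf fun g => ?_
  let K : 𝒰.CompactSubfields := image Φ ⊔ image ((autEmbedding g).comp Ψ)
  have hΦ : ∀ x, Φ.onDom x ∈ (K : Set 𝒰.dom) := fun x => Or.inl ⟨x, rfl⟩
  have hΨ : ∀ y, ((autEmbedding g).comp Ψ).onDom y ∈ (K : Set 𝒰.dom) := fun y => Or.inr ⟨y, rfl⟩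
  refine (ghEDist_le _ (CompactSubfields.codRestrict K Φ hΦ)
    (CompactSubfields.codRestrict K _ hΨ)).trans (le_of_eq ?_)
  rw [← hausdorffEDist_image (CompactSubfields.incl K).isometry_onDom, ← range_comp, ← range_comp]
  change hausdorffEDist (range Φ.onDom) (range (g.1.1 ∘ Ψ.onDom)) =
    hausdorffEDist (range Φ.onDom) (g.1.1 '' range Ψ.onDom)
  rw [range_comp]

theorem edist_orbit_image (h𝒰 : 𝒰.IsUltimateUrysohn) {X Y : CompactField.{u}}
    (Φ : FieldEmbedding X.toPolishField 𝒰) (Ψ : FieldEmbedding Y.toPolishField 𝒰) :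
    edist (𝒰.orbit (image Φ)) (𝒰.orbit (image Ψ)) = X.ghEDist Y :=
  le_antisymm (edist_orbit_image_le h𝒰 Φ Ψ) (ghEDist_le_orbitEDist Φ Ψ)

theorem ghEDist_ne_top (h𝒰 : 𝒰.IsUltimateUrysohn) (X Y : CompactField.{u}) :
    X.ghEDist Y ≠ ⊤ := by
  obtain ⟨Φ⟩ := h𝒰.nonempty_embedding X.toPolishField
  obtain ⟨Ψ⟩ := h𝒰.nonempty_embedding Y.toPolishField
  refine ne_top_of_le_ne_top ?_ ((ghEDist_le_orbitEDist Φ Ψ).trans (iInf_le _ 1))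
  rw [one_smul]
  exact hausdorffEDist_ne_top_of_nonempty_of_bounded (image Φ).nonempty (image Ψ).nonempty
    (image Φ).isCompact.isBounded (image Ψ).isCompact.isBounded

/-- The condition makes π(x) ↦ π(f(x)) an isometric relation; once the codomains are the images,
both of its projections are everything. -/
theorem isometric_restrictCod {X Y : CompactField.{u}} (f : X.dom ≃ᵢ Y.dom)
    (h : ∀ x x', dist (X.map x) (X.map x') = dist (Y.map (f x)) (Y.map (f x'))) :
    X.restrictCod.toPolishField.Isometric Y.restrictCod.toPolishField := by
  let R : Set (X.restrictCod.cod × Y.restrictCod.cod) :=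
    range fun x : X.dom => (X.restrictCod.map x, Y.restrictCod.map (f x))
  have hR : IsIsometricRel R := by
    rintro _ ⟨x, rfl⟩ _ ⟨x', rfl⟩
    exact h x x'
  have h1 : Prod.fst '' R = univ := eq_univ_of_forall fun z => by
    obtain ⟨_, x, rfl⟩ := z
    exact ⟨_, ⟨x, rfl⟩, rfl⟩
  have h2 : Prod.snd '' R = univ := eq_univ_of_forall fun z => by
    obtain ⟨_, y, rfl⟩ := z
    obtain ⟨x, rfl⟩ := f.surjective y
    exact ⟨_, ⟨x, rfl⟩, rfl⟩
  obtain ⟨g, hg⟩ := hR.exists_isometryEquiv (h1 ▸ dense_univ) (h2 ▸ dense_univ)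
  exact ⟨f, g, fun x => (hg _ ⟨x, rfl⟩).symm⟩

/-- The distance compares domains only, and the restricted field sits in X with the same domain. -/
theorem ghEDist_restrictCod (X : CompactField.{u}) : X.ghEDist X.restrictCod = 0 := by
  let Ψ : FieldEmbedding X.restrictCod.toPolishField X.toPolishField :=
    ⟨id, Subtype.val, isometry_id, isometry_subtype_coe, fun _ => rfl⟩
  refine le_antisymm ((ghEDist_le X ⟨id, id, isometry_id, isometry_id, fun _ => rfl⟩ Ψ).trans
    ?_) bot_le
  exact hausdorffEDist_self.le

theorem ghEDist_eq_zero_iff (h𝒰 : 𝒰.IsUltimateUrysohn) (X Y : CompactField.{u}) :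
    X.ghEDist Y = 0 ↔ X.restrictCod.toPolishField.Isometric Y.restrictCod.toPolishField := by
  constructor
  · intro h
    obtain ⟨Φ⟩ := h𝒰.nonempty_embedding X.toPolishField
    obtain ⟨Ψ⟩ := h𝒰.nonempty_embedding Y.toPolishField
    obtain ⟨g, hg⟩ := h𝒰.exists_smul_eq_of_orbitEDist_eq_zero
      (le_antisymm ((edist_orbit_image_le h𝒰 Φ Ψ).trans h.le) bot_le)
    have hrange : range ((autEmbedding g).comp Ψ).onDom = range Φ.onDom :=
      (range_comp g.1.1 Ψ.onDom).trans (congrArg SetLike.coe hg)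
    have hex : ∀ x, ∃ y, ((autEmbedding g).comp Ψ).onDom y = Φ.onDom x := fun x =>
      hrange.symm.subset (mem_range_self x)
    have hex' : ∀ y, ∃ x, Φ.onDom x = ((autEmbedding g).comp Ψ).onDom y := fun y =>
      hrange.subset (mem_range_self y)
    choose f hf using hex
    choose f' hf' using hex'
    refine isometric_restrictCod (IsometryEquiv.mk' f f' (fun y => ?_)
      (Isometry.of_dist_eq fun x x' => ?_)) fun x x' => ?_
    · apply ((autEmbedding g).comp Ψ).isometry_onDom.injective
      rw [hf, hf']
    · rw [← ((autEmbedding g).comp Ψ).isometry_onDom.dist_eq, hf, hf, Φ.isometry_onDom.dist_eq]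
    · change _ = dist (Y.map (f x)) (Y.map (f x'))
      rw [← ((autEmbedding g).comp Ψ).dist_map, hf, hf, Φ.dist_map]
  · intro h
    refine le_antisymm ((ghEDist_triangle X X.restrictCod Y).trans ?_) bot_le
    rw [ghEDist_restrictCod, zero_add]
    refine (ghEDist_triangle _ Y.restrictCod Y).trans ?_
    rw [ghEDist_eq_zero_of_isometric h, ghEDist_comm _ Y, ghEDist_restrictCod, add_zero]

theorem toModuli_surjective : Function.Surjective toModuli.{u} := by
  intro m
  induction m using Quotient.inductionOn with | _ a
  induction a using Quotient.inductionOn with | _ X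
  exact ⟨X, rfl⟩

theorem exists_isometryEquiv_subfieldOrbits (h𝒰 : 𝒰.IsUltimateUrysohn) :
    ∃ e : FieldModuli.{u} ≃ᵢ 𝒰.SubfieldOrbits,
      ∀ (X : CompactField.{u}) (Φ : FieldEmbedding X.toPolishField 𝒰),
        e X.toModuli = 𝒰.orbit (image Φ) := by
  choose X hX using toModuli_surjective
  choose Φ _ using fun m => exists_true_iff_nonempty.2
    (h𝒰.nonempty_embedding (X m).toPolishField)
  let e : FieldModuli.{u} → 𝒰.SubfieldOrbits := fun m => 𝒰.orbit (image (Φ m))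
  have he : Isometry e := fun m m' => by
    rw [edist_orbit_image h𝒰, ← edist_toModuli, hX, hX]
  -- Independence of the chosen representative and embedding: the two orbits are at distance 0,
  -- hence equal.
  have heq : ∀ (Y : CompactField.{u}) (Ψ : FieldEmbedding Y.toPolishField 𝒰),
      e Y.toModuli = 𝒰.orbit (image Ψ) := fun Y Ψ => by
    refine h𝒰.eq_of_edist_orbit_eq_zero ?_
    rw [edist_orbit_image h𝒰, ← edist_toModuli, hX, edist_self]
  have hsurj : Function.Surjective e := by
    intro a
    induction a using Quotient.inductionOn with | _ A
    refine ⟨(CompactSubfields.toField A).toModuli, ?_⟩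
    rw [heq _ (CompactSubfields.incl A), CompactSubfields.image_incl]
    rfl
  exact ⟨⟨Equiv.ofBijective e ⟨he.injective, hsurj⟩, he⟩, heq⟩

end CompactField

end

theorem mainTheorem4 (𝒰 : PolishField.{u}) (h𝒰 : 𝒰.IsUltimateUrysohn) :
    (∀ X Y : CompactField.{u}, X.ghEDist Y ≠ ⊤) ∧
    (∀ X Y : CompactField.{u}, X.ghEDist Y = 0 ↔
      X.restrictCod.toPolishField.Isometric Y.restrictCod.toPolishField) ∧
    (∀ X : CompactField.{u}, Nonempty (FieldEmbedding X.toPolishField 𝒰)) ∧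
    ∃ e : FieldModuli.{u} ≃ᵢ 𝒰.SubfieldOrbits,
      ∀ (X : CompactField.{u}) (Φ : FieldEmbedding X.toPolishField 𝒰),
        e X.toModuli = 𝒰.orbit (CompactField.image Φ) :=
  ⟨CompactField.ghEDist_ne_top h𝒰, CompactField.ghEDist_eq_zero_iff h𝒰,
    fun X => h𝒰.nonempty_embedding X.toPolishField,
    CompactField.exists_isometryEquiv_subfieldOrbits h𝒰⟩
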